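/- All sets of functions below carry the topology of pointwise convergence. Let $X$ be a non-empty topological space and let $SC_p(X)\subset\mathbb R^X$ be the space of all scatteredly continuous functions $f:X\to\mathbb R$, i.e. those for which, for each non-empty $A\subset X$, the restriction $f|A$ has a point of continuity. Recall that $X$ has countable tightness if for each $A\subset X$ and $a\in\overline{A}$ there is an at most countable $B\subset A$ with $a\in\overline{B}$. Call $X$ scatteredly $R$-separable if for each non-empty countable subspace $Z\subset X$ without isolated points and each sequence $(D_n)_{n\in\omega}$ of dense subsets of $Z$ there are points $z_n\in D_n$, $n\in\omega$, such that the subspace $\{z_n\}_{n\in\omega}$ is not scattered, i.e. has a non-empty subspace without isolated points. For a topological space $Y$, the weight $w(Y)$ is the smallest cardinality of a base of the topology of $Y$; the Lindelöf number $l(Y)$ is the smallest infinite cardinal $\kappa$ such that each open cover of $Y$ has a subcover of cardinality at most $\kappa$; $hl(Y)=\sup\{l(Z):Z\subset Y\}$; the compact density $kd(Y)$ is the smallest cardinality of a family of compact subsets of $Y$ whose union is dense in $Y$; and $h_{cl}kd(Y)=\sup\{kd(C):C\text{ is a closed subspace of }Y\}$. **Corollary 9.2.** Suppose that $X$ is regular,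 has countable tightness and is scatteredly $R$-separable. Then each compact convex subset $F\subset SC_p(X)$ is weakly discontinuous, that is, each non-empty subset $A\subset X$ contains an open dense subset $U\subset A$ such that $f|U$ is continuous for every $f\in F$. Moreover, $$w(F)\le hl(X)\cdot h_{cl}kd(X).$$ -/

import Mathlib

open Set TopologicalSpace
open scoped Cardinal

universe u v

/-- `f` is scatteredly continuous: for each non-empty `A ⊆ X` the restriction `f|A` has a point
of continuity. -/
def ScatteredlyContinuous {X : Type u} {Y : Type v} [TopologicalSpace X] [TopologicalSpace Y]
    (f : X → Y) : Prop :=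
  ∀ A : Set X, A.Nonempty → ∃ a ∈ A, ContinuousWithinAt f A a

/-- The set of scatteredly continuous real functions on `X`, inside the space `X → ℝ`, whose
topology is that of pointwise convergence. -/
def SCp (X : Type u) [TopologicalSpace X] : Set (X → ℝ) :=
  {f | ScatteredlyContinuous f}

/-- A function family `𝓕` is weakly discontinuous: each non-empty `A ⊆ X` contains a subset
`U = A ∩ V`, open and dense in `A`, such that all restrictions `f|U`, `f ∈ 𝓕`, are continuous. -/
def WeaklyDiscontinuousFamily {X : Type u} {Y : Type v} [TopologicalSpace X] [TopologicalSpace Y]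
    (𝓕 : Set (X → Y)) : Prop :=
  ∀ A : Set X, A.Nonempty →
    ∃ V : Set X, IsOpen V ∧ A ⊆ closure (A ∩ V) ∧ ∀ f ∈ 𝓕, ContinuousOn f (A ∩ V)

/-- Countable tightness. -/
def CountablyTight (X : Type u) [TopologicalSpace X] : Prop :=
  ∀ (A : Set X) (a : X), a ∈ closure A → ∃ B ⊆ A, B.Countable ∧ a ∈ closure B

/-- A subset `S` is scattered: each non-empty subset of `S` has an isolated point.
(`Preperfect A` says that the subspace `A` has no isolated points.) -/
def ScatteredSet {X : Type u} [TopologicalSpace X] (S : Set X) : Prop :=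
  ∀ A ⊆ S, A.Nonempty → ¬ Preperfect A

/-- Scattered R-separability: for each non-empty countable subspace `Z` without isolated points
and each sequence of dense subsets `D n` of `Z` one can choose points `z n ∈ D n` forming a
non-scattered subspace. -/
def ScatteredlyRSeparable (X : Type u) [TopologicalSpace X] : Prop :=
  ∀ Z : Set X, Z.Nonempty → Z.Countable → Preperfect Z →
    ∀ D : ℕ → Set X, (∀ n, D n ⊆ Z ∧ Z ⊆ closure (D n)) →
      ∃ z : ℕ → X, (∀ n, z n ∈ D n) ∧ ¬ ScatteredSet (range z)

/-- The weight: the smallest cardinality of a base of the topology. -/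
noncomputable def topWeight (X : Type u) [TopologicalSpace X] : Cardinal.{u} :=
  sInf {κ | ∃ B : Set (Set X), IsTopologicalBasis B ∧ #B = κ}

/-- The Lindelöf number: the smallest infinite cardinal `κ` such that each open cover has a
subcover of cardinality at most `κ`. -/
noncomputable def lindelofNumber (X : Type u) [TopologicalSpace X] : Cardinal.{u} :=
  sInf {κ | ℵ₀ ≤ κ ∧ ∀ 𝒰 : Set (Set X), (∀ U ∈ 𝒰, IsOpen U) → ⋃₀ 𝒰 = univ →
    ∃ 𝒱 ⊆ 𝒰, ⋃₀ 𝒱 = univ ∧ #𝒱 ≤ κ}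

/-- The hereditary Lindelöf number: the supremum of the Lindelöf numbers of all subspaces. -/
noncomputable def hereditaryLindelofNumber (X : Type u) [TopologicalSpace X] : Cardinal.{u} :=
  ⨆ Z : Set X, lindelofNumber Z

/-- The compact density: the smallest cardinality of a family of compact subsets with dense
union. -/
noncomputable def compactDensity (X : Type u) [TopologicalSpace X] : Cardinal.{u} :=
  sInf {κ | ∃ 𝒞 : Set (Set X), (∀ K ∈ 𝒞, IsCompact K) ∧ Dense (⋃₀ 𝒞) ∧ #𝒞 = κ}

/-- The closed hereditary compact density: the supremum of the compact densities of all closed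
subspaces. -/
noncomputable def closedHereditaryCompactDensity (X : Type u) [TopologicalSpace X] :
    Cardinal.{u} :=
  ⨆ F : {F : Set X // IsClosed F}, compactDensity F.1

/-!
The proof has two independent halves.

*Weak discontinuity.* It suffices to find, in every non-empty set `A`, a non-empty relatively open
piece on which all `f ∈ 𝓕` are continuous. If `A` has no such piece, countable tightness yields a
countable `Z ⊆ A` with a dense set of points at which some `f ∈ 𝓕` is discontinuous on `Z`; in
particular `Z` has no isolated points. Fix `f₀ ∈ 𝓕`. If `|f - f₀|` were bounded on some open piece of
`Z`, uniformly in `f ∈ 𝓕`, then Baire's theorem in the metric of uniform convergence would give a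
single `g ∈ 𝓕` with a dense set of discontinuities on this piece
(`exists_forall_not_continuousWithinAt`), which is impossible for a scatteredly continuous function
(`ScatteredlyContinuous.exists_isOpen_continuousOn`). So the sets
`D n = {z ∈ Z | |f z - f₀ z| ≥ Nₙ for some f ∈ 𝓕}` are dense, and scattered R-separability gives
`z n ∈ D n` forming a non-scattered set. By a counting argument on a grid of convex combinations
(`exists_convex_combination_large`) and by compactness, some `g ∈ 𝓕` satisfies `|g (z n)| ≥ n` for
all `n`; but such a `g` has no continuity point on a crowded subset of `{z n}`. The last step needs
finite sets to be discrete, so one first passes to a set of representatives of the inseparability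
classes, which in a regular space is a `T₁` subspace.

*Weight.* A pointwise compact family of continuous functions on a compact space has small
oscillation on some non-empty open set (`exists_isOpen_forall_abs_sub_le`, the fragmentability of
weakly compact sets). An induction over open sets (`hereditaryLindelof_induction`) turns this into a
set of at most `hl(X)` points of a compact set `K` at which the members of `𝓕` are determined on `K`,
provided they are continuous on `K`. A second such induction, using the first half, regularity and
the compact density of closed sets, gives `hl(X) · h_cl kd(X)` points which determine the members of
`𝓕` on `X`, and `𝓕`, being compact, embeds into a product of that many real lines.
-/

open Filter Topology

/-! ### Closing off under countable operations -/

/-- Every point lies in a countable set closed under a given operation which assigns countable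
sets to finite sets. -/
theorem exists_countable_closed_under {α : Type*} (T : Set α → Set α)
    (hT : ∀ s : Set α, s.Finite → (T s).Countable) (a : α) :
    ∃ Z : Set α, Z.Countable ∧ a ∈ Z ∧ ∀ s ⊆ Z, s.Finite → T s ⊆ Z := by
  let Φ : Set α → Set α := fun Y => Y ∪ ⋃ s ∈ {s : Set α | s.Finite ∧ s ⊆ Y}, T s
  let Z : ℕ → Set α := fun n => Φ^[n] {a}
  have hsucc : ∀ n, Z (n + 1) = Φ (Z n) := fun n => Function.iterate_succ_apply' _ _ _
  have hmono : Monotone Z := monotone_nat_of_le_succ fun n => by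
    rw [hsucc]; exact subset_union_left
  have hcount : ∀ n, (Z n).Countable := by
    intro n
    induction n with
    | zero => exact countable_singleton a
    | succ n ih =>
      rw [hsucc]
      exact ih.union ((countable_ofPred_finite_subset ih).biUnion fun s hs => hT s hs.1)
  refine ⟨⋃ n, Z n, countable_iUnion hcount, mem_iUnion.2 ⟨0, rfl⟩, fun s hs hfin => ?_⟩
  obtain ⟨n, hn⟩ : ∃ n, s ⊆ Z n := by
    have := hmono.directed_le.exists_mem_subset_of_finset_subset_biUnion
      (s := hfin.toFinset) (by simpa using hs)
    simpa using this
  refine Subset.trans ?_ (subset_iUnion Z (n + 1))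
  rw [hsucc]
  exact fun x hx => Or.inr (mem_iUnion₂.2 ⟨s, ⟨hfin, hn⟩, hx⟩)

/-! ### Scatteredly continuous functions -/

section Single

variable {X : Type u} [TopologicalSpace X]

/-- A scatteredly continuous real function is weakly discontinuous. Otherwise the discontinuity
points of `f|A` would be dense in some open piece of `A`; near a continuity point of `f` restricted
to the set of discontinuity points all values at these points are close to each other, and then so
are all values at continuity points of `f|A`, by density. -/
theorem ScatteredlyContinuous.exists_isOpen_continuousOn {f : X → ℝ}
    (hf : ScatteredlyContinuous f) {A : Set X} (hA : A.Nonempty) :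
    ∃ V, IsOpen V ∧ (A ∩ V).Nonempty ∧ ContinuousOn f (A ∩ V) := by
  by_contra! hcon
  set D : Set X := {x ∈ A | ¬ ContinuousWithinAt f A x} with hD
  have hdense : ∀ V, IsOpen V → (A ∩ V).Nonempty → (D ∩ V).Nonempty := by
    intro V hV hne
    have h := hcon V hV hne
    simp only [ContinuousOn, not_forall] at h
    obtain ⟨x, hx, hxc⟩ := h
    exact ⟨x, ⟨hx.1, fun hc => hxc (hc.mono inter_subset_left)⟩, hx.2⟩
  obtain ⟨x, hxD, hxc⟩ := hf D (by
    obtain ⟨x, hx, -⟩ := hdense univ isOpen_univ (by simpa using hA)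
    exact ⟨x, hx⟩)
  apply hxD.2
  rw [Metric.continuousWithinAt_iff'] at hxc ⊢
  intro ε hε
  have h1 := hxc (ε / 2) (by positivity)
  rw [eventually_nhdsWithin_iff, eventually_nhds_iff] at h1
  obtain ⟨U, hU, hUo, hxU⟩ := h1
  rw [eventually_nhdsWithin_iff]
  filter_upwards [hUo.mem_nhds hxU] with y hyU hyA
  by_cases hyD : y ∈ D
  · exact (hU y hyU hyD).trans (by linarith)
  · have hyc : ContinuousWithinAt f A y := by
      by_contra h
      exact hyD ⟨hyA, h⟩
    rw [Metric.continuousWithinAt_iff'] at hyc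
    have h2 := hyc (ε / 2) (by positivity)
    rw [eventually_nhdsWithin_iff, eventually_nhds_iff] at h2
    obtain ⟨W, hW, hWo, hyW⟩ := h2
    obtain ⟨d, hdD, hdU, hdW⟩ := hdense (U ∩ W) (hUo.inter hWo) ⟨y, hyA, hyU, hyW⟩
    have h3 := hU d hdU hdD
    have h4 := hW d hdW hdD.1
    rw [dist_comm] at h4
    linarith [dist_triangle (f y) (f d) (f x)]

/-- A scatteredly continuous function takes equal values at inseparable points. -/
theorem ScatteredlyContinuous.eq_of_inseparable {f : X → ℝ} (hf : ScatteredlyContinuous f)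
    {x y : X} (h : Inseparable x y) : f x = f y := by
  have key : ∀ a b : X, Inseparable a b → ContinuousWithinAt f {a, b} a → f a = f b := by
    intro a b hab hc
    rw [Metric.continuousWithinAt_iff'] at hc
    by_contra hne
    have h1 := hc (dist (f b) (f a)) (dist_pos.2 (Ne.symm hne))
    rw [eventually_nhdsWithin_iff, hab.nhds_eq] at h1
    exact lt_irrefl _ (h1.self_of_nhds (by simp))
  obtain ⟨a, ha, hc⟩ := hf {x, y} ⟨x, by simp⟩
  rcases ha with rfl | rfl
  · exact key _ _ h hc
  · rw [pair_comm] at hc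
    exact (key _ _ h.symm hc).symm

end Single

/-! ### Convex combinations on a grid -/

/-- Finitely many subsets `B i` of a finite grid do not cover it if every `B i` meets each line in
direction `i` in at most one point and the sum of the inverse side lengths is less than one. -/
theorem exists_grid_point_avoiding {N : ℕ} (K : Fin N → ℕ) (hK : ∀ i, 0 < K i)
    (hsum : ∑ i, (1 : ℝ) / K i < 1) (B : ∀ _ : Fin N, Set (∀ j, Fin (K j)))
    (hB : ∀ i, ∀ t ∈ B i, ∀ t' ∈ B i, (∀ j, j ≠ i → t j = t' j) → t = t') :
    ∃ t, ∀ i, t ∉ B i := by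
  classical
  by_contra! hcov
  have hline : ∀ i, (B i).toFinset.card * K i ≤ Fintype.card (∀ j, Fin (K j)) := by
    intro i
    have hinj : Function.Injective
        (fun p : (B i) × Fin (K i) => (Function.update p.1.1 i p.2 : ∀ j, Fin (K j))) := by
      rintro ⟨⟨t, ht⟩, k⟩ ⟨⟨t', ht'⟩, k'⟩ h
      have hk : k = k' := by simpa using congrFun h i
      have ht2 : t = t' := hB i t ht t' ht' fun j hj => by simpa [hj] using congrFun h j
      subst hk ht2; rfl
    have := Fintype.card_le_of_injective _ hinj
    rwa [Fintype.card_prod, Fintype.card_fin, ← Set.toFinset_card] at this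
  have hG : (0 : ℝ) < Fintype.card (∀ j, Fin (K j)) := by
    have : Nonempty (∀ j, Fin (K j)) := ⟨fun j => ⟨0, hK j⟩⟩
    exact_mod_cast Fintype.card_pos
  have h1 : (Fintype.card (∀ j, Fin (K j)) : ℝ) ≤ ∑ i, ((B i).toFinset.card : ℝ) := by
    have : (Finset.univ : Finset (∀ j, Fin (K j))) ⊆
        Finset.univ.biUnion fun i => (B i).toFinset := by
      intro t _
      obtain ⟨i, hi⟩ := hcov t
      simpa using ⟨i, hi⟩
    have := (Finset.card_le_card this).trans Finset.card_biUnion_le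
    rw [Finset.card_univ] at this
    exact_mod_cast this
  have h2 : ∑ i, ((B i).toFinset.card : ℝ) ≤
      ∑ i, Fintype.card (∀ j, Fin (K j)) * ((1 : ℝ) / K i) := by
    refine Finset.sum_le_sum fun i _ => ?_
    have : (0 : ℝ) < K i := by exact_mod_cast hK i
    rw [mul_one_div, le_div_iff₀ this]
    exact_mod_cast hline i
  rw [← Finset.mul_sum] at h2
  nlinarith

/-- The grid of convex combinations `g₀ + ∑ cₙ tₙ (fₙ - g₀)`, `0 ≤ tₙ < 2 ^ (n + 2)`: if the gaps
`|fₙ (zₙ) - g₀ (zₙ)|` grow fast enough, some point of the grid satisfies `n ≤ |g (zₙ)|` for all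
`n < N`. -/
theorem exists_convex_combination_large {X : Type*} {𝓕 : Set (X → ℝ)} (hconv : Convex ℝ 𝓕)
    {g₀ : X → ℝ} (hg₀ : g₀ ∈ 𝓕) (z : ℕ → X) (f : ℕ → X → ℝ) (hf : ∀ n, f n ∈ 𝓕)
    (hbig : ∀ n : ℕ, 2 * n * 2 ^ (2 * n + 3) ≤ |f n (z n) - g₀ (z n)|) (N : ℕ) :
    ∃ g ∈ 𝓕, ∀ n < N, (n : ℝ) ≤ |g (z n)| := by
  classical
  -- The step `c n` times the number `2 ^ (n + 2)` of grid points is `2 ^ (-(n + 1))`, so that all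
  -- weights sum to less than one; and one step in direction `n` moves the value at `z n` by at least
  -- `2 * n`, so that at most one point of each line in this direction is bad.
  let c : ℕ → ℝ := fun n => 1 / 2 ^ (2 * n + 3)
  have hc : ∀ n, 0 < c n := fun n => by positivity
  let K : Fin N → ℕ := fun i => 2 ^ ((i : ℕ) + 2)
  let comb : (∀ i, Fin (K i)) → X → ℝ := fun t =>
    g₀ + ∑ i : Fin N, (c i * (t i : ℕ)) • (f i - g₀)
  have hgeo : ∀ M : ℕ, ∑ i : Fin M, (1 : ℝ) / 2 ^ ((i : ℕ) + 1) < 1 := by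
    intro M
    have : ∑ i : Fin M, (1 : ℝ) / 2 ^ ((i : ℕ) + 1) = 1 - 1 / 2 ^ M := by
      rw [Fin.sum_univ_eq_sum_range (fun i => (1 : ℝ) / 2 ^ (i + 1)) M]
      induction M with
      | zero => simp
      | succ M ih => rw [Finset.sum_range_succ, ih]; field_simp; ring
    rw [this]
    have : (0 : ℝ) < 1 / 2 ^ M := by positivity
    linarith
  have hmem : ∀ t, comb t ∈ 𝓕 := by
    intro t
    have hle : ∑ i : Fin N, c i * (t i : ℕ) ≤ 1 := by
      refine le_trans (Finset.sum_le_sum fun i _ => ?_) (hgeo N).le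
      have h1 : ((t i : ℕ) : ℝ) ≤ 2 ^ ((i : ℕ) + 2) := by exact_mod_cast (t i).2.le
      calc c i * (t i : ℕ) ≤ c i * 2 ^ ((i : ℕ) + 2) := by gcongr
        _ = 1 / 2 ^ ((i : ℕ) + 1) := by
          simp only [c]; field_simp; ring
    have heq : comb t = (1 - ∑ i : Fin N, c i * (t i : ℕ)) • g₀ +
        ∑ i : Fin N, (c i * (t i : ℕ)) • f i := by
      simp only [comb, smul_sub, Finset.sum_sub_distrib, sub_smul, one_smul, Finset.sum_smul]
      abel
    have := hconv.sum_mem (t := (Finset.univ : Finset (Option (Fin N))))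
      (w := fun o => o.elim (1 - ∑ i : Fin N, c i * (t i : ℕ)) fun i => c i * (t i : ℕ))
      (z := fun o => o.elim g₀ fun i => f i)
      (by rintro (_ | i) -
          · simpa using hle
          · exact mul_nonneg (hc i).le (Nat.cast_nonneg _))
      (by simp [Fintype.sum_option])
      (by rintro (_ | i) -
          · exact hg₀
          · exact hf i)
    rw [heq]
    simpa [Fintype.sum_option] using this
  obtain ⟨t, ht⟩ := exists_grid_point_avoiding K (fun i => by positivity) (by
      refine lt_of_le_of_lt (Finset.sum_le_sum fun i _ => ?_) (hgeo N)
      simp only [K]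
      push_cast
      gcongr <;> norm_num)
    (fun i => {t | |comb t (z i)| < (i : ℕ)}) (by
      intro i t ht t' ht' hoff
      funext j
      by_cases hj : j = i
      swap
      · exact hoff j hj
      subst hj
      by_contra hne
      have hdiff : comb t (z j) - comb t' (z j) =
          c j * (((t j : ℕ) : ℝ) - (t' j : ℕ)) * (f j (z j) - g₀ (z j)) := by
        simp only [comb, Pi.add_apply, Finset.sum_apply, Pi.smul_apply, Pi.sub_apply, smul_eq_mul]
        rw [add_sub_add_left_eq_sub, ← Finset.sum_sub_distrib, Finset.sum_eq_single j]
        · ring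
        · intro i _ hi; rw [hoff i hi]; ring
        · simp
      have habs : (1 : ℝ) ≤ |((t j : ℕ) : ℝ) - (t' j : ℕ)| := by
        have : ((t j : ℕ) : ℤ) - (t' j : ℕ) ≠ 0 := by
          intro h
          exact hne (Fin.ext (by omega))
        exact_mod_cast Int.one_le_abs this
      have h1 : |comb t (z j) - comb t' (z j)| < 2 * (j : ℕ) := by
        have h2 := abs_sub (comb t (z j)) (comb t' (z j))
        simp only [mem_ofPred_eq] at ht ht'
        linarith
      rw [hdiff, abs_mul, abs_mul, abs_of_pos (hc j)] at h1
      have h3 : (2 * (j : ℕ) : ℝ) ≤ c j * |f j (z j) - g₀ (z j)| := by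
        have := mul_le_mul_of_nonneg_left (hbig j) (hc j).le
        refine le_trans (le_of_eq ?_) this
        simp only [c]; field_simp
      have h4 : c j * |f j (z j) - g₀ (z j)| ≤
          c j * |((t j : ℕ) : ℝ) - (t' j : ℕ)| * |f j (z j) - g₀ (z j)| := by
        have := mul_nonneg (hc j).le (abs_nonneg (f j (z j) - g₀ (z j)))
        nlinarith
      linarith)
  exact ⟨comb t, hmem t, fun n hn => not_lt.1 (ht ⟨n, hn⟩)⟩

/-! ### A single function with many discontinuities -/

section Baire

variable {X : Type u} [TopologicalSpace X]

open UniformConvergence in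
/-- In a compact convex family whose members are at bounded distance from each other on `W`, a
single member is discontinuous at all points of a countable set at each of which some member is
discontinuous. In the metric of uniform convergence on `W` the family is complete, the members
continuous at a given point form a closed set, and this set has no interior, as one sees by moving
slightly towards a discontinuous member; so Baire's theorem applies. -/
theorem exists_forall_not_continuousWithinAt {𝓕 : Set (X → ℝ)} (hcomp : IsCompact 𝓕)
    (hconv : Convex ℝ 𝓕) (hne : 𝓕.Nonempty) {W S : Set X} (hSW : S ⊆ W) (hS : S.Countable) {C : ℝ}
    (hC : ∀ f ∈ 𝓕, ∀ g ∈ 𝓕, ∀ x ∈ W, |f x - g x| ≤ C)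
    (hdisc : ∀ s ∈ S, ∃ f ∈ 𝓕, ¬ ContinuousWithinAt f W s) :
    ∃ g ∈ 𝓕, ∀ s ∈ S, ¬ ContinuousWithinAt g W s := by
  let R : (X → ℝ) → (W →ᵤ ℝ) := fun f => UniformFun.ofFun fun x : W => f x
  let G : Set (W →ᵤ ℝ) := R '' 𝓕
  have hGc : IsClosed G := by
    have h1 : IsCompact ((fun f : X → ℝ => fun x : W => f x) '' 𝓕) :=
      hcomp.image (continuous_pi fun x => continuous_apply _)
    have h2 := h1.isClosed.preimage
      (UniformFun.uniformContinuous_toFun (α := W) (β := ℝ)).continuous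
    exact h2
  have : CompleteSpace G := hGc.completeSpace_coe
  have hGne : Nonempty G := (hne.image R).to_subtype
  have : Countable S := hS.to_subtype
  let E : S → Set G := fun s => {φ | ContinuousAt (UniformFun.toFun φ.1) ⟨s, hSW s.2⟩}
  have hE : ∀ f (hf : f ∈ 𝓕) (s : S),
      (⟨R f, mem_image_of_mem R hf⟩ : G) ∈ E s ↔ ContinuousWithinAt f W s := by
    intro f hf s
    rw [continuousWithinAt_iff_continuousAt_domRestrict f (hSW s.2)]
    rfl
  by_contra! hcon
  have hcover : ⋃ s, E s = univ := by
    rw [eq_univ_iff_forall]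
    rintro ⟨_, f, hf, rfl⟩
    obtain ⟨s, hs, hc⟩ := hcon f hf
    exact mem_iUnion.2 ⟨⟨s, hs⟩, (hE f hf _).2 hc⟩
  have hclosed : ∀ s, IsClosed (E s) := by
    intro s
    refine isClosed_of_closure_subset fun φ hφ => ?_
    rw [EMetric.mem_closure_iff] at hφ
    refine continuousAt_of_locally_uniform_approx_of_continuousAt fun u hu => ?_
    obtain ⟨ε, hε, hεu⟩ := mem_uniformity_edist.1 hu
    obtain ⟨ψ, hψ, hφψ⟩ := hφ ε hε
    refine ⟨univ, univ_mem, UniformFun.toFun ψ.1, hψ, fun y _ => hεu ?_⟩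
    rw [Subtype.edist_eq, UniformFun.edist_def] at hφψ
    exact (le_iSup (fun x => edist (UniformFun.toFun φ.1 x) (UniformFun.toFun ψ.1 x)) y).trans_lt
      hφψ
  obtain ⟨s, ⟨φ, hφ⟩⟩ := nonempty_interior_of_iUnion_of_closed hclosed hcover
  obtain ⟨f, hf, hfs⟩ := hdisc s s.2
  obtain ⟨⟨_, g, hg, rfl⟩, hgE⟩ : ∃ φ, φ ∈ interior (E s) := ⟨φ, hφ⟩
  obtain ⟨ε, hε, hball⟩ := EMetric.mem_nhds_iff.1 (mem_interior_iff_mem_nhds.1 hgE)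
  have hgs := (hE g hg s).1 (interior_subset hgE)
  obtain ⟨t, ht0, ht1, htε⟩ : ∃ t : ℝ, 0 < t ∧ t ≤ 1 ∧ ENNReal.ofReal (t * C) < ε := by
    have hlim : Tendsto (fun t : ℝ => ENNReal.ofReal (t * C)) (𝓝[>] 0) (𝓝 0) := by
      have : Continuous fun t : ℝ => ENNReal.ofReal (t * C) :=
        ENNReal.continuous_ofReal.comp (continuous_id.mul continuous_const)
      simpa using (this.tendsto 0).mono_left nhdsWithin_le_nhds
    obtain ⟨t, h1, h2⟩ := ((hlim.eventually_lt_const hε).and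
      (Ioc_mem_nhdsGT (zero_lt_one' ℝ))).exists
    exact ⟨t, h2.1, h2.2, h1⟩
  have hh : (1 - t) • g + t • f ∈ 𝓕 := hconv hg hf (by linarith) ht0.le (by ring)
  have hhE := hball (show (⟨_, mem_image_of_mem R hh⟩ : G) ∈ _ by
    rw [Metric.mem_eball, Subtype.edist_eq]
    refine lt_of_le_of_lt (UniformFun.edist_le.2 fun x => ?_) htε
    change edist (((1 - t) • g + t • f) x) (g x) ≤ _
    rw [edist_dist, Real.dist_eq]
    refine ENNReal.ofReal_le_ofReal ?_
    have : ((1 - t) • g + t • f) x - g x = t * (f x - g x) := by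
      simp only [Pi.add_apply, Pi.smul_apply, smul_eq_mul]; ring
    rw [this, abs_mul, abs_of_pos ht0]
    exact mul_le_mul_of_nonneg_left (hC f hf g hg x x.2) ht0.le)
  have hhs := (hE _ hh s).1 hhE
  apply hfs
  have hf' : f = fun x => t⁻¹ * (((1 - t) • g + t • f) x - (1 - t) * g x) := by
    funext x
    simp only [Pi.add_apply, Pi.smul_apply, smul_eq_mul]
    field_simp
    ring
  rw [hf']
  exact continuousWithinAt_const.mul (hhs.sub (continuousWithinAt_const.mul hgs))

end Baire

/-! ### Weak discontinuity of compact convex families -/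

section Weak

variable {X : Type u} [TopologicalSpace X]

/-- Let `Z` be countable such that each point of a dense subset is a discontinuity point of `f|Z`
for some `f` in the family. The members are then unboundedly far from each other near every point:
otherwise a single member would be discontinuous on a dense subset of an open piece of `Z`. -/
theorem exists_ge_of_dense_discontinuities {𝓕 : Set (X → ℝ)} (hSC : 𝓕 ⊆ SCp X)
    (hcomp : IsCompact 𝓕) (hconv : Convex ℝ 𝓕) {Z : Set X} (hZ : Z.Countable)
    (hdense : Z ⊆ closure {z ∈ Z | ∃ f ∈ 𝓕, ¬ ContinuousWithinAt f Z z})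
    {g₀ : X → ℝ} (hg₀ : g₀ ∈ 𝓕) (C : ℝ) :
    Z ⊆ closure {z ∈ Z | ∃ f ∈ 𝓕, C ≤ |f z - g₀ z|} := by
  intro a haZ
  rw [mem_closure_iff]
  intro V hV haV
  by_contra hcon
  have hbd : ∀ f ∈ 𝓕, ∀ x ∈ Z ∩ V, |f x - g₀ x| ≤ C := by
    intro f hf x hx
    by_contra h
    exact hcon ⟨x, hx.2, hx.1, f, hf, (not_le.1 h).le⟩
  set S := {z ∈ Z | ∃ f ∈ 𝓕, ¬ ContinuousWithinAt f Z z} ∩ V with hS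
  have hloc : ∀ O, IsOpen O → ∀ (f : X → ℝ) (B : Set X) (s : X), s ∈ O →
      (ContinuousWithinAt f (B ∩ O) s ↔ ContinuousWithinAt f B s) := fun O hO f B s hs =>
    continuousWithinAt_inter (hO.mem_nhds hs)
  obtain ⟨g, hg, hgS⟩ := exists_forall_not_continuousWithinAt hcomp hconv ⟨g₀, hg₀⟩
    (W := Z ∩ V) (S := S) (C := C + C) (inter_subset_inter_left _ (sep_subset _ _))
    (hZ.mono fun x hx => hx.1.1)
    (fun f hf g hg x hx => by
      have h1 := hbd f hf x hx
      have h2 := hbd g hg x hx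
      rw [abs_sub_comm] at h2
      linarith [abs_sub_le (f x) (g₀ x) (g x)])
    (by
      rintro s ⟨⟨hsZ, f, hf, hfs⟩, hsV⟩
      exact ⟨f, hf, by rwa [hloc V hV f Z s hsV]⟩)
  obtain ⟨O, hO, ⟨x, hx, hxO⟩, hcont⟩ := (hSC hg).exists_isOpen_continuousOn
    (A := Z ∩ V) ⟨a, haZ, haV⟩
  obtain ⟨s, ⟨hsV, hsO⟩, hs⟩ := mem_closure_iff.1 (hdense hx.1) (V ∩ O) (hV.inter hO) ⟨hx.2, hxO⟩
  refine hgS s ⟨hs, hsV⟩ ?_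
  rw [← hloc O hO _ _ _ hsO]
  exact hcont s ⟨⟨hs.1, hsV⟩, hsO⟩

/-- Discontinuity at a point is witnessed by a countable subset. -/
theorem CountablyTight.exists_countable_not_continuousWithinAt (hT : CountablyTight X)
    {f : X → ℝ} {A : Set X} {a : X} (h : ¬ ContinuousWithinAt f A a) :
    ∃ B ⊆ A, B.Countable ∧ ∀ Z, B ⊆ Z → ¬ ContinuousWithinAt f Z a := by
  rw [Metric.continuousWithinAt_iff'] at h
  push Not at h
  obtain ⟨ε, hε, h⟩ := h
  have hcl : a ∈ closure (A ∩ {x | ¬ dist (f x) (f a) < ε}) := by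
    rw [mem_closure_iff_frequently]
    rw [frequently_nhdsWithin_iff] at h
    exact h.mono fun x hx => ⟨hx.2, not_lt.2 hx.1⟩
  obtain ⟨B, hBA, hB, haB⟩ := hT _ _ hcl
  refine ⟨B, fun x hx => (hBA hx).1, hB, fun Z hBZ hc => ?_⟩
  rw [Metric.continuousWithinAt_iff'] at hc
  have h1 := hc ε hε
  rw [eventually_nhdsWithin_iff] at h1
  rw [mem_closure_iff_frequently] at haB
  obtain ⟨x, hx, hx'⟩ := (haB.and_eventually h1).exists
  exact (hBA hx).2 (hx' (hBZ hx))

/-- The main step towards weak discontinuity, for sets without topologically indistinguishable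
points. -/
theorem exists_isOpen_forall_continuousOn_of_inseparable [RegularSpace X]
    (hT : CountablyTight X) (hR : ScatteredlyRSeparable X)
    {𝓕 : Set (X → ℝ)} (hSC : 𝓕 ⊆ SCp X) (hcomp : IsCompact 𝓕) (hconv : Convex ℝ 𝓕)
    {A : Set X} (hA : A.Nonempty) (hins : ∀ x ∈ A, ∀ y ∈ A, Inseparable x y → x = y) :
    ∃ V, IsOpen V ∧ (A ∩ V).Nonempty ∧ ∀ f ∈ 𝓕, ContinuousOn f (A ∩ V) := by
  by_contra! hcon
  set B : Set X := {a ∈ A | ∃ f ∈ 𝓕, ¬ ContinuousWithinAt f A a} with hB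
  have hAB : A ⊆ closure B := by
    intro a ha
    rw [mem_closure_iff]
    intro V hV haV
    obtain ⟨f, hf, hfc⟩ := hcon V hV ⟨a, ha, haV⟩
    simp only [ContinuousOn, not_forall] at hfc
    obtain ⟨x, hx, hxc⟩ := hfc
    exact ⟨x, hx.2, hx.1, f, hf, fun hc => hxc (hc.mono inter_subset_left)⟩
  -- A countable subset of `A` on which the density of discontinuities survives.
  have hT1 : ∀ a : X, ∃ T : Set X, T.Countable ∧ (a ∈ A → T ⊆ A ∧ a ∈ closure (B ∩ T) ∧
      (a ∈ B → ∃ f ∈ 𝓕, ∀ Z, T ⊆ Z → ¬ ContinuousWithinAt f Z a)) := by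
    intro a
    by_cases ha : a ∈ A
    swap
    · exact ⟨∅, countable_empty, fun h => absurd h ha⟩
    obtain ⟨T₁, h1, h2, h3⟩ := hT B a (hAB ha)
    have h3' : ∀ T, T₁ ⊆ T → a ∈ closure (B ∩ T) := fun T hT =>
      closure_mono (subset_inter h1 hT) h3
    by_cases haB : a ∈ B
    · obtain ⟨-, f, hf, hfa⟩ := haB
      obtain ⟨T₂, h4, h5, h6⟩ := hT.exists_countable_not_continuousWithinAt hfa
      exact ⟨T₁ ∪ T₂, h2.union h5, fun _ => ⟨union_subset (h1.trans (sep_subset _ _)) h4,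
        h3' _ subset_union_left, fun _ => ⟨f, hf, fun Z hZ => h6 Z (subset_union_right.trans hZ)⟩⟩⟩
    · exact ⟨T₁, h2, fun _ => ⟨h1.trans (sep_subset _ _), h3' _ Subset.rfl, fun h => absurd h haB⟩⟩
  choose T hTc hT' using hT1
  obtain ⟨a₀, ha₀⟩ := hA
  obtain ⟨Z', hZ'c, haZ', hZ'T⟩ := exists_countable_closed_under (fun s => ⋃ x ∈ s, T x)
    (fun s hs => hs.countable.biUnion fun x _ => hTc x) a₀
  set Z := Z' ∩ A with hZ
  have hZc : Z.Countable := hZ'c.mono inter_subset_left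
  have hZT : ∀ z ∈ Z, T z ⊆ Z := fun z hz =>
    subset_inter (by simpa using hZ'T {z} (by simpa using hz.1) (finite_singleton z))
      (hT' z hz.2).1
  have hdense : Z ⊆ closure {z ∈ Z | ∃ f ∈ 𝓕, ¬ ContinuousWithinAt f Z z} := by
    intro z hz
    refine closure_mono ?_ (hT' z hz.2).2.1
    rintro x ⟨hxB, hxT⟩
    have hxZ := hZT z hz hxT
    obtain ⟨f, hf, hfx⟩ := (hT' x hxZ.2).2.2 hxB
    exact ⟨hxZ, f, hf, hfx Z (hZT x hxZ)⟩
  have hpre : Preperfect Z := by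
    rw [preperfect_iff_nhds]
    intro z hz U hU
    by_contra! hiso
    obtain ⟨x, hxU, hxZ, f, hf, hfx⟩ := mem_closure_iff.1 (hdense hz) (interior U) isOpen_interior
      (mem_interior_iff_mem_nhds.2 hU)
    have hxz := hiso x ⟨interior_subset hxU, hxZ⟩
    subst hxz
    refine hfx ((continuousWithinAt_inter hU).1 ?_)
    have : Z ∩ U = {x} := by
      ext y
      exact ⟨fun hy => hiso y ⟨hy.2, hy.1⟩, by rintro rfl; exact ⟨hxZ, mem_of_mem_nhds hU⟩⟩
    rw [this]
    exact continuousWithinAt_singleton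
  obtain ⟨f₀, hf₀, -⟩ := hcon univ isOpen_univ (by simpa using ⟨a₀, ha₀⟩)
  obtain ⟨z, hzD, hzs⟩ := hR Z ⟨a₀, haZ', ha₀⟩ hZc hpre
    (fun n => {z ∈ Z | ∃ f ∈ 𝓕, 2 * n * 2 ^ (2 * n + 3) ≤ |f z - f₀ z|}) fun n =>
      ⟨sep_subset _ _, exists_ge_of_dense_discontinuities hSC hcomp hconv hZc hdense hf₀ _⟩
  choose hzZ f hf hfz using hzD
  -- By compactness a single member of the family is at least `n` at every `z n`.
  obtain ⟨g, hg⟩ : (⋂ N : ℕ, 𝓕 ∩ {g | ∀ n < N, (n : ℝ) ≤ |g (z n)|}).Nonempty := by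
    have hcl : ∀ N : ℕ, IsClosed {g : X → ℝ | ∀ n < N, (n : ℝ) ≤ |g (z n)|} := by
      intro N
      simp only [ofPred_forall]
      exact isClosed_iInter fun n => isClosed_iInter fun _ =>
        isClosed_le continuous_const (continuous_apply (z n)).abs
    refine IsCompact.nonempty_iInter_of_sequence_nonempty_isCompact_isClosed _ ?_ ?_ ?_ ?_
    · exact fun N => inter_subset_inter_right _ fun g hg n hn => hg n (hn.trans N.lt_succ_self)
    · intro N
      obtain ⟨g, hg, h⟩ := exists_convex_combination_large hconv hf₀ z f hf hfz N
      exact ⟨g, hg, h⟩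
    · exact hcomp.inter_right (hcl 0)
    · exact fun N => hcomp.isClosed.inter (hcl N)
  rw [mem_iInter] at hg
  have hgz : ∀ n : ℕ, (n : ℝ) ≤ |g (z n)| := fun n => (hg (n + 1)).2 n n.lt_succ_self
  simp only [ScatteredSet, not_forall, not_not] at hzs
  obtain ⟨P, hPz, hPne, hP⟩ := hzs
  obtain ⟨p, hpP, hpc⟩ := hSC (hg 0).1 P hPne
  -- Near a continuity point only finitely many `z n` can occur.
  rw [Metric.continuousWithinAt_iff'] at hpc
  have h1 := hpc 1 one_pos
  rw [eventually_nhdsWithin_iff] at h1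
  set Q : Set X := {x ∈ P | dist (g x) (g p) < 1} with hQ
  have hQfin : Q.Finite := by
    obtain ⟨M, hM⟩ := exists_nat_gt (|g p| + 1)
    refine ((finite_lt_nat M).image z).subset ?_
    rintro x ⟨hxP, hx⟩
    obtain ⟨n, rfl⟩ := hPz hxP
    refine ⟨n, ?_, rfl⟩
    have h2 := hgz n
    rw [Real.dist_eq] at hx
    have h3 := abs_sub_abs_le_abs_sub (g (z n)) (g p)
    have : (n : ℝ) < M := by linarith
    exact_mod_cast this
  -- In a regular space distinct points of `A` have different closures, so `p` is isolated in `P`.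
  have hsep : ∀ᶠ x in 𝓝 p, ∀ y ∈ Q, y ≠ p → x ≠ y := by
    rw [eventually_all_finite hQfin]
    intro y hy
    by_cases hyp : y = p
    · simp [hyp]
    have hnot : ¬ y ⤳ p := by
      intro h
      obtain ⟨n, rfl⟩ := hPz hy.1
      obtain ⟨m, rfl⟩ := hPz hpP
      exact hyp (hins _ (hzZ n).2 _ (hzZ m).2 (specializes_iff_inseparable.1 h))
    rw [specializes_iff_forall_open] at hnot
    push Not at hnot
    obtain ⟨U, hU, hpU, hyU⟩ := hnot
    filter_upwards [hU.mem_nhds hpU] with x hx _ hxy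
    exact hyU (hxy ▸ hx)
  obtain ⟨y, ⟨hy1, hyP⟩, hyp⟩ := preperfect_iff_nhds.1 hP p hpP _ (h1.and hsep)
  exact hy1.2 y ⟨hyP, hy1.1 hyP⟩ hyp rfl

/-- Each non-empty set has a non-empty relatively open subset on which all members of the family
are continuous. As scatteredly continuous functions do not distinguish inseparable points, it is
enough to consider one point of each inseparability class. -/
theorem exists_isOpen_forall_continuousOn [RegularSpace X]
    (hT : CountablyTight X) (hR : ScatteredlyRSeparable X)
    {𝓕 : Set (X → ℝ)} (hSC : 𝓕 ⊆ SCp X) (hcomp : IsCompact 𝓕) (hconv : Convex ℝ 𝓕)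
    {A : Set X} (hA : A.Nonempty) :
    ∃ V, IsOpen V ∧ (A ∩ V).Nonempty ∧ ∀ f ∈ 𝓕, ContinuousOn f (A ∩ V) := by
  obtain ⟨A', hA'A, hbij⟩ := exists_subset_bijOn A (SeparationQuotient.mk : X → _)
  have hrep : ∀ x ∈ A, ∃ y ∈ A', Inseparable x y := by
    intro x hx
    obtain ⟨y, hy, hxy⟩ := hbij.surjOn (mem_image_of_mem _ hx)
    exact ⟨y, hy, (SeparationQuotient.mk_eq_mk.1 hxy).symm⟩
  obtain ⟨V, hV, hne, hcont⟩ := exists_isOpen_forall_continuousOn_of_inseparable hT hR hSC hcomp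
    hconv (A := A') (by obtain ⟨x, hx⟩ := hA; obtain ⟨y, hy, -⟩ := hrep x hx; exact ⟨y, hy⟩)
    (fun x hx y hy h => hbij.injOn hx hy (SeparationQuotient.mk_eq_mk.2 h))
  refine ⟨V, hV, hne.mono (inter_subset_inter_left _ hA'A), fun f hf x hx => ?_⟩
  obtain ⟨x', hx', hxx'⟩ := hrep x hx.1
  have hc := hcont f hf x' ⟨hx', (hxx'.mem_open_iff hV).1 hx.2⟩
  rw [Metric.continuousWithinAt_iff'] at hc ⊢
  intro ε hε
  have h1 := hc ε hε
  rw [eventually_nhdsWithin_iff, eventually_nhds_iff] at h1 ⊢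
  obtain ⟨U, hU, hUo, hxU⟩ := h1
  refine ⟨U, fun y hyU hy => ?_, hUo, (hxx'.mem_open_iff hUo).2 hxU⟩
  obtain ⟨y', hy', hyy'⟩ := hrep y hy.1
  rw [(hSC hf).eq_of_inseparable hyy', (hSC hf).eq_of_inseparable hxx']
  exact hU y' ((hyy'.mem_open_iff hUo).1 hyU) ⟨hy', (hyy'.mem_open_iff hV).1 hy.2⟩

/-- To prove weak discontinuity it suffices to find non-empty relatively open subsets of joint
continuity: the union of all open sets of joint continuity is then dense. -/
theorem weaklyDiscontinuousFamily_of_exists {𝓕 : Set (X → ℝ)}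
    (h : ∀ A : Set X, A.Nonempty →
      ∃ V, IsOpen V ∧ (A ∩ V).Nonempty ∧ ∀ f ∈ 𝓕, ContinuousOn f (A ∩ V)) :
    WeaklyDiscontinuousFamily 𝓕 := by
  intro A _
  refine ⟨⋃₀ {V | IsOpen V ∧ ∀ f ∈ 𝓕, ContinuousOn f (A ∩ V)}, isOpen_sUnion fun V hV => hV.1,
    fun a ha => ?_, ?_⟩
  · rw [mem_closure_iff]
    intro O hO haO
    obtain ⟨V, hV, ⟨x, ⟨hxA, hxO⟩, hxV⟩, hc⟩ := h (A ∩ O) ⟨a, ha, haO⟩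
    exact ⟨x, hxO, hxA, mem_sUnion.2 ⟨O ∩ V, ⟨hO.inter hV, by rwa [← inter_assoc]⟩, hxO, hxV⟩⟩
  · rintro f hf x ⟨hxA, V, ⟨hV, hc⟩, hxV⟩
    exact ((continuousWithinAt_inter (hV.mem_nhds hxV)).1 (hc f hf x ⟨hxA, hxV⟩)).mono
      inter_subset_left

end Weak

/-! ### Pointwise compact families of continuous functions on a compact space -/

/-- A weakly compact set is fragmented by the norm: on some non-empty open set all members of a
pointwise compact family of continuous functions on a compact space oscillate by at most `ε`.
If this fails, then it fails for a countable subfamily on all cylinders given by this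
subfamily. The image `L` of the space under the subfamily is compact and metrizable, hence so is the
closure `𝓖` of the subfamily, so that `C(𝓖, ℝ)` is separable. Thus `L` is covered by countably many
closed sets on which the oscillations are small, and Baire's theorem gives a contradiction. -/
theorem exists_isOpen_forall_abs_sub_le {Y : Type*} [TopologicalSpace Y] [CompactSpace Y]
    [Nonempty Y] {𝓕 : Set (Y → ℝ)} (hcomp : IsCompact 𝓕) (hcont : ∀ f ∈ 𝓕, Continuous f)
    {ε : ℝ} (hε : 0 < ε) :
    ∃ V : Set Y, IsOpen V ∧ V.Nonempty ∧ ∀ f ∈ 𝓕, ∀ x ∈ V, ∀ y ∈ V, |f x - f y| ≤ ε := by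
  by_contra! hcon
  obtain ⟨f₀, hf₀, -⟩ := hcon univ isOpen_univ univ_nonempty
  let cyl : Set ((Y → ℝ) × ℚ × ℚ) → Set Y := fun s =>
    {y | ∀ p ∈ s, p.1 y ∈ Ioo (p.2.1 : ℝ) (p.2.2 : ℝ)}
  have hosc : ∀ V : Set Y, ∃ f ∈ 𝓕, IsOpen V → V.Nonempty →
      ∃ x ∈ V, ∃ y ∈ V, ε < |f x - f y| := by
    intro V
    by_cases h : IsOpen V ∧ V.Nonempty
    · obtain ⟨f, hf, x, hx, y, hy, hxy⟩ := hcon V h.1 h.2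
      exact ⟨f, hf, fun _ _ => ⟨x, hx, y, hy, hxy⟩⟩
    · exact ⟨f₀, hf₀, fun h1 h2 => absurd ⟨h1, h2⟩ h⟩
  choose φ hφ𝓕 hφ using hosc
  obtain ⟨Z, hZc, hf₀Z, hZ⟩ := exists_countable_closed_under
    (fun s : Set ((Y → ℝ) × ℚ × ℚ) => (insert (φ (cyl s)) (Prod.fst '' s)) ×ˢ univ)
    (fun s hs => ((hs.image _).insert _).countable.prod countable_univ) (f₀, 0, 0)
  -- The countable subfamily, and the map to a metrizable space given by it.
  let 𝓖₀ : Set (Y → ℝ) := 𝓕 ∩ Prod.fst '' Z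
  have h𝓖₀Z : ∀ f ∈ 𝓖₀, ∀ a b : ℚ, (f, a, b) ∈ Z := by
    rintro f ⟨-, p, hp, rfl⟩ a b
    exact hZ {p} (by simpa using hp) (finite_singleton p) ⟨Or.inr ⟨p, rfl, rfl⟩, mem_univ _⟩
  have h𝓖₀c : 𝓖₀.Countable := (hZc.image _).mono inter_subset_right
  have : Countable 𝓖₀ := h𝓖₀c.to_subtype
  have hosc₀ : ∀ s : Set ((Y → ℝ) × ℚ × ℚ), s.Finite → (∀ p ∈ s, p.1 ∈ 𝓖₀) → (cyl s).Nonempty →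
      ∃ f ∈ 𝓖₀, ∃ x ∈ cyl s, ∃ y ∈ cyl s, ε < |f x - f y| := by
    intro s hs hs𝓖 hne
    have hopen : IsOpen (cyl s) := by
      have : cyl s = ⋂ p ∈ s, p.1 ⁻¹' Ioo (p.2.1 : ℝ) (p.2.2 : ℝ) := by ext; simp [cyl]
      rw [this]
      exact hs.isOpen_biInter fun p hp => isOpen_Ioo.preimage (hcont _ (hs𝓖 p hp).1)
    have hmem : (φ (cyl s), (0 : ℚ), (0 : ℚ)) ∈ Z :=
      hZ s (fun p hp => h𝓖₀Z p.1 (hs𝓖 p hp) _ _) hs ⟨Or.inl rfl, mem_univ _⟩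
    exact ⟨φ (cyl s), ⟨hφ𝓕 _, _, hmem, rfl⟩, hφ _ hopen hne⟩
  let q : Y → 𝓖₀ → ℝ := fun y f => f.1 y
  have hq : Continuous q := continuous_pi fun f => hcont f.1 f.2.1
  let q' : Y → range q := rangeFactorization q
  have hq' : Continuous q' := hq.subtype_mk _
  have hq's : Function.Surjective q' := rangeFactorization_surjective
  have : CompactSpace (range q) := isCompact_iff_compactSpace.1 (isCompact_range hq)
  have hquot : IsQuotientMap q' := hq'.isClosedMap.isQuotientMap hq' hq's
  let σ : range q → Y := Function.surjInv hq's
  have hσ : ∀ l, q' (σ l) = l := Function.surjInv_eq hq's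
  -- The closure of the subfamily consists of continuous functions of the image point.
  let 𝓖 : Set (Y → ℝ) := closure 𝓖₀
  have h𝓖𝓕 : 𝓖 ⊆ 𝓕 := closure_minimal inter_subset_left hcomp.isClosed
  have h𝓖comp : IsCompact 𝓖 := hcomp.of_isClosed_subset isClosed_closure h𝓖𝓕
  have : CompactSpace 𝓖 := isCompact_iff_compactSpace.1 h𝓖comp
  have hfac : ∀ f ∈ 𝓖, ∀ x y, q' x = q' y → f x = f y := by
    intro f hf x y hxy
    have hcl : IsClosed {f : Y → ℝ | f x = f y} :=
      isClosed_eq (continuous_apply x) (continuous_apply y)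
    refine closure_minimal (fun f hf => ?_) hcl hf
    exact congrFun (congrArg Subtype.val hxy) ⟨f, hf⟩
  have hfσ : ∀ f ∈ 𝓖, ∀ y, f (σ (q' y)) = f y := fun f hf y => hfac f hf _ _ (hσ _)
  have hcσ : ∀ f ∈ 𝓖, Continuous fun l => f (σ l) := by
    intro f hf
    rw [hquot.continuous_iff]
    exact (hcont f (h𝓖𝓕 hf)).congr fun y => (hfσ f hf y).symm
  obtain ⟨S, hSc, hSd⟩ := exists_countable_dense (range q)
  have : Countable S := hSc.to_subtype
  let r : 𝓖 → S → ℝ := fun f s => f.1 (σ s)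
  have hr : Continuous r :=
    continuous_pi fun s => (continuous_apply (σ s)).comp continuous_subtype_val
  have hrinj : Function.Injective r := by
    intro f g hfg
    have heq : (fun l => f.1 (σ l)) = fun l => g.1 (σ l) :=
      (hcσ f f.2).ext_on hSd (hcσ g g.2) fun s hs => congrFun hfg ⟨s, hs⟩
    ext y
    rw [← hfσ f f.2, ← hfσ g g.2]
    exact congrFun heq (q' y)
  have : SecondCountableTopology 𝓖 :=
    (hr.isClosedEmbedding hrinj).isInducing.secondCountableTopology
  let ev : Y → C(𝓖, ℝ) := fun y =>
    ⟨fun f => f.1 y, (continuous_apply y).comp continuous_subtype_val⟩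
  let E : ℕ → Set (range q) := fun n =>
    {l | ∀ f : 𝓖, |f.1 (σ l) - denseSeq C(𝓖, ℝ) n f| ≤ ε / 2}
  have hEc : ∀ n, IsClosed (E n) := by
    intro n
    simp only [E, ofPred_forall]
    exact isClosed_iInter fun f =>
      isClosed_le ((hcσ f f.2).sub continuous_const).abs continuous_const
  have hEcov : ⋃ n, E n = univ := by
    rw [eq_univ_iff_forall]
    intro l
    obtain ⟨n, hn⟩ := (denseRange_denseSeq C(𝓖, ℝ)).exists_dist_lt (ev (σ l)) (half_pos hε)
    refine mem_iUnion.2 ⟨n, fun f => ?_⟩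
    have := (ContinuousMap.dist_apply_le_dist (f := ev (σ l)) (g := denseSeq C(𝓖, ℝ) n) f).trans
      hn.le
    rwa [Real.dist_eq] at this
  have : Nonempty (range q) := (range_nonempty q).to_subtype
  obtain ⟨n, ⟨l, hl⟩⟩ := nonempty_interior_of_iUnion_of_closed hEc hEcov
  obtain ⟨V, hV, hVE⟩ := isOpen_induced_iff.1 (isOpen_interior (s := E n))
  obtain ⟨I, u, hu, huV⟩ := isOpen_pi_iff.1 hV l.1 (show l ∈ Subtype.val ⁻¹' V by rwa [hVE])
  have hrat : ∀ i : 𝓖₀, ∃ a b : ℚ, i ∈ I → l.1 i ∈ Ioo (a : ℝ) b ∧ Ioo (a : ℝ) b ⊆ u i := by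
    intro i
    by_cases hi : i ∈ I
    · obtain ⟨_, hw, h1, h2⟩ := Real.isTopologicalBasis_Ioo_rat.exists_subset_of_mem_open
        (hu i hi).2 (hu i hi).1
      simp only [mem_iUnion, mem_singleton_iff] at hw
      obtain ⟨a, b, -, rfl⟩ := hw
      exact ⟨a, b, fun _ => ⟨h1, h2⟩⟩
    · exact ⟨0, 0, fun h => absurd h hi⟩
  choose a b hab using hrat
  have hlσ : ∀ i : 𝓖₀, i.1 (σ l) = l.1 i := fun i => congrFun (congrArg Subtype.val (hσ l)) i
  have hcyl : ∀ x ∈ cyl ((fun i : 𝓖₀ => (i.1, a i, b i)) '' I), q' x ∈ E n := by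
    intro x hx
    apply interior_subset
    rw [← hVE]
    exact huV fun i hi => (hab i hi).2 (hx _ ⟨i, hi, rfl⟩)
  obtain ⟨f, hf, x, hx, y, hy, hxy⟩ := hosc₀ ((fun i : 𝓖₀ => (i.1, a i, b i)) '' I)
    (I.finite_toSet.image _) (by rintro _ ⟨i, -, rfl⟩; exact i.2)
    ⟨σ l, by
      rintro _ ⟨i, hi, rfl⟩
      change i.1 (σ l) ∈ Ioo (a i : ℝ) (b i)
      rw [hlσ]
      exact (hab i hi).1⟩
  have hf𝓖 : f ∈ 𝓖 := subset_closure hf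
  have h1 : |f (σ (q' x)) - denseSeq C(𝓖, ℝ) n ⟨f, hf𝓖⟩| ≤ ε / 2 := hcyl x hx ⟨f, hf𝓖⟩
  have h2 : |f (σ (q' y)) - denseSeq C(𝓖, ℝ) n ⟨f, hf𝓖⟩| ≤ ε / 2 := hcyl y hy ⟨f, hf𝓖⟩
  rw [hfσ f hf𝓖] at h1 h2
  rw [abs_sub_comm] at h2
  linarith [abs_sub_le (f x) (denseSeq C(𝓖, ℝ) n ⟨f, hf𝓖⟩) (f y)]

/-- The form of `exists_isOpen_forall_abs_sub_le` for compact subsets. -/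
theorem IsCompact.exists_isOpen_forall_abs_sub_le {X : Type*} [TopologicalSpace X] {K : Set X}
    (hK : IsCompact K) (hne : K.Nonempty) {𝓕 : Set (X → ℝ)} (hcomp : IsCompact 𝓕)
    (hcont : ∀ f ∈ 𝓕, ContinuousOn f K) {ε : ℝ} (hε : 0 < ε) :
    ∃ V : Set X, IsOpen V ∧ (K ∩ V).Nonempty ∧
      ∀ f ∈ 𝓕, ∀ x ∈ K ∩ V, ∀ y ∈ K ∩ V, |f x - f y| ≤ ε := by
  have : CompactSpace K := isCompact_iff_compactSpace.1 hK
  have : Nonempty K := hne.to_subtype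
  obtain ⟨V, hV, ⟨x, hx⟩, hosc⟩ := _root_.exists_isOpen_forall_abs_sub_le
    (𝓕 := (fun f : X → ℝ => fun x : K => f x) '' 𝓕)
    (hcomp.image (continuous_pi fun x => continuous_apply _))
    (by rintro _ ⟨f, hf, rfl⟩; exact (hcont f hf).domRestrict) hε
  obtain ⟨U, hU, rfl⟩ := isOpen_induced_iff.1 hV
  exact ⟨U, hU, ⟨x, x.2, hx⟩, fun f hf x hx y hy =>
    hosc _ ⟨f, hf, rfl⟩ ⟨x, hx.1⟩ hx.2 ⟨y, hy.1⟩ hy.2⟩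

/-! ### Cardinal functions -/

section Cardinal

variable {X : Type u} [TopologicalSpace X]

theorem lindelofNumber_spec (X : Type u) [TopologicalSpace X] :
    ℵ₀ ≤ lindelofNumber X ∧ ∀ 𝒰 : Set (Set X), (∀ U ∈ 𝒰, IsOpen U) → ⋃₀ 𝒰 = univ →
      ∃ 𝒱 ⊆ 𝒰, ⋃₀ 𝒱 = univ ∧ #𝒱 ≤ lindelofNumber X := by
  refine csInf_mem (s := {κ : Cardinal.{u} | ℵ₀ ≤ κ ∧ ∀ 𝒰 : Set (Set X), (∀ U ∈ 𝒰, IsOpen U) →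
    ⋃₀ 𝒰 = univ → ∃ 𝒱 ⊆ 𝒰, ⋃₀ 𝒱 = univ ∧ #𝒱 ≤ κ}) ⟨max ℵ₀ #(Set X), le_max_left _ _, ?_⟩
  exact fun 𝒰 _ h => ⟨𝒰, Subset.rfl, h, (Cardinal.mk_set_le 𝒰).trans (le_max_right _ _)⟩

theorem lindelofNumber_le_hereditaryLindelofNumber (Z : Set X) :
    lindelofNumber Z ≤ hereditaryLindelofNumber X :=
  le_ciSup (f := fun Z : Set X => lindelofNumber Z) Cardinal.bddAbove_of_small Z

theorem aleph0_le_hereditaryLindelofNumber : ℵ₀ ≤ hereditaryLindelofNumber X :=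
  (lindelofNumber_spec _).1.trans (lindelofNumber_le_hereditaryLindelofNumber (∅ : Set X))

theorem exists_subset_sUnion_eq_mk_le (𝒰 : Set (Set X)) (h𝒰 : ∀ U ∈ 𝒰, IsOpen U) :
    ∃ 𝒱 ⊆ 𝒰, ⋃₀ 𝒱 = ⋃₀ 𝒰 ∧ #𝒱 ≤ hereditaryLindelofNumber X := by
  let ι : Set X → Set (⋃₀ 𝒰 : Set X) := fun U => Subtype.val ⁻¹' U
  obtain ⟨𝒱, h𝒱, hcov, hcard⟩ := (lindelofNumber_spec (⋃₀ 𝒰 : Set X)).2 (ι '' 𝒰)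
    (by rintro _ ⟨U, hU, rfl⟩; exact (h𝒰 U hU).preimage continuous_subtype_val)
    (by
      rw [eq_univ_iff_forall]
      rintro ⟨x, U, hU, hx⟩
      exact ⟨ι U, mem_image_of_mem _ hU, hx⟩)
  obtain ⟨𝒲, h𝒲, hbij⟩ := SurjOn.exists_bijOn_subset (f := ι) h𝒱
  refine ⟨𝒲, h𝒲, (sUnion_subset_sUnion h𝒲).antisymm fun x hx => ?_, ?_⟩
  · obtain ⟨_, hV, hxV⟩ := (eq_univ_iff_forall.1 hcov) ⟨x, hx⟩
    obtain ⟨U, hU, rfl⟩ := hbij.surjOn hV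
    exact ⟨U, hU, hxV⟩
  · rw [Cardinal.mk_congr (hbij.equiv ι)]
    exact hcard.trans (lindelofNumber_le_hereditaryLindelofNumber _)

/-- Induction over open sets, replacing a transfinite exhaustion of the space: a property of open
sets which passes to unions of at most `hl(X)` sets, and which never holds for a proper open subset
without holding for some open set not contained in it, holds for the whole space. -/
theorem hereditaryLindelof_induction {P : Set X → Prop}
    (hunion : ∀ 𝒱 : Set (Set X), #𝒱 ≤ hereditaryLindelofNumber X → (∀ V ∈ 𝒱, P V) → P (⋃₀ 𝒱))
    (hext : ∀ O, IsOpen O → P O → O ≠ univ → ∃ V, IsOpen V ∧ P V ∧ ¬ V ⊆ O) : P univ := by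
  let 𝒰 : Set (Set X) := {V | IsOpen V ∧ P V}
  obtain ⟨𝒱, h𝒱, heq, hcard⟩ := exists_subset_sUnion_eq_mk_le 𝒰 fun V hV => hV.1
  have hP : P (⋃₀ 𝒰) := heq ▸ hunion 𝒱 hcard fun V hV => (h𝒱 hV).2
  by_contra hcon
  obtain ⟨V, hV, hPV, hnot⟩ := hext (⋃₀ 𝒰) (isOpen_sUnion fun V hV => hV.1) hP
    fun h => hcon (h ▸ hP)
  exact hnot (subset_sUnion_of_mem ⟨hV, hPV⟩)

theorem mk_biUnion_le_of_le {α β : Type u} {s : Set α} {κ μ : Cardinal.{u}} (hμ : ℵ₀ ≤ μ)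
    (hκ : κ ≤ μ) (hs : #s ≤ κ) (D : α → Set β) (hD : ∀ a ∈ s, #(D a) ≤ μ) :
    #(⋃ a ∈ s, D a : Set β) ≤ μ :=
  (Cardinal.mk_biUnion_le D s).trans <|
    (mul_le_mul' (hs.trans hκ) (ciSup_le' fun a : s => hD a.1 a.2)).trans (Cardinal.mul_eq_self hμ).le

/-- A pointwise compact family of functions, continuous on the compact set `K`, admits a subset of
`K` of cardinality at most `hl(X)` which approximates all points of `K` uniformly on the family. -/
theorem IsCompact.exists_uniform_net {K : Set X} (hK : IsCompact K) {𝓕 : Set (X → ℝ)}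
    (hcomp : IsCompact 𝓕) (hcont : ∀ f ∈ 𝓕, ContinuousOn f K) {ε : ℝ} (hε : 0 < ε) :
    ∃ D : Set X, D ⊆ K ∧ #D ≤ hereditaryLindelofNumber X ∧
      ∀ x ∈ K, ∃ d ∈ D, ∀ f ∈ 𝓕, |f x - f d| ≤ ε := by
  have key := hereditaryLindelof_induction (X := X) (P := fun O => ∃ D : Set X, D ⊆ K ∧
    #D ≤ hereditaryLindelofNumber X ∧ ∀ x ∈ K ∩ O, ∃ d ∈ D, ∀ f ∈ 𝓕, |f x - f d| ≤ ε) ?_ ?_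
  · simpa using key
  · intro 𝒱 hcard h𝒱
    choose! D hDK hD hDx using h𝒱
    refine ⟨⋃ V ∈ 𝒱, D V, iUnion₂_subset hDK,
      mk_biUnion_le_of_le aleph0_le_hereditaryLindelofNumber le_rfl hcard D hD, ?_⟩
    rintro x ⟨hxK, V, hV, hxV⟩
    obtain ⟨d, hd, h⟩ := hDx V hV x ⟨hxK, hxV⟩
    exact ⟨d, mem_biUnion hV hd, h⟩
  · rintro O hO ⟨D, hDK, hD, hDx⟩ hOne
    by_cases hKO : K ⊆ O
    · exact ⟨univ, isOpen_univ, ⟨D, hDK, hD, fun x hx => hDx x ⟨hx.1, hKO hx.1⟩⟩,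
        fun h => hOne (univ_subset_iff.1 h)⟩
    · obtain ⟨V, hV, ⟨d, ⟨hdK, hdO⟩, hdV⟩, hosc⟩ :=
        (hK.diff hO).exists_isOpen_forall_abs_sub_le (sdiff_nonempty.2 hKO) hcomp
          (fun f hf => (hcont f hf).mono sdiff_subset) hε
      refine ⟨O ∪ V, hO.union hV, ⟨insert d D, insert_subset hdK hDK, ?_, ?_⟩,
        fun h => hdO (h (Or.inr hdV))⟩
      · refine Cardinal.mk_insert_le.trans ?_
        exact Cardinal.add_le_of_le aleph0_le_hereditaryLindelofNumber hD
          (Cardinal.one_le_aleph0.trans aleph0_le_hereditaryLindelofNumber)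
      · rintro x ⟨hxK, hx⟩
        by_cases hxO : x ∈ O
        · obtain ⟨e, he, h⟩ := hDx x ⟨hxK, hxO⟩
          exact ⟨e, mem_insert_of_mem _ he, h⟩
        · exact ⟨d, mem_insert _ _, fun f hf =>
            hosc f hf x ⟨⟨hxK, hxO⟩, hx.resolve_left hxO⟩ d ⟨⟨hdK, hdO⟩, hdV⟩⟩

theorem IsCompact.exists_separating {K : Set X} (hK : IsCompact K) {𝓕 : Set (X → ℝ)}
    (hcomp : IsCompact 𝓕) (hcont : ∀ f ∈ 𝓕, ContinuousOn f K) :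
    ∃ D : Set X, #D ≤ hereditaryLindelofNumber X ∧
      ∀ f ∈ 𝓕, ∀ g ∈ 𝓕, EqOn f g D → EqOn f g K := by
  choose D hDK hD hDx using fun n : ℕ =>
    hK.exists_uniform_net hcomp hcont (ε := 1 / ((n : ℝ) + 1)) (by positivity)
  refine ⟨⋃ n, D n, ?_, fun f hf g hg hfg x hx => ?_⟩
  · have h1 := Cardinal.mk_iUnion_le_lift D
    simp only [Cardinal.lift_uzero, Cardinal.mk_nat, Cardinal.lift_aleph0] at h1
    refine h1.trans ?_
    refine (mul_le_mul' (aleph0_le_hereditaryLindelofNumber (X := X)) (ciSup_le' hD)).trans ?_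
    exact (Cardinal.mul_eq_self aleph0_le_hereditaryLindelofNumber).le
  · by_contra hne
    have hpos : 0 < |f x - g x| / 2 := half_pos (abs_pos.2 (sub_ne_zero.2 hne))
    obtain ⟨n, hn⟩ := exists_nat_one_div_lt hpos
    obtain ⟨d, hd, h⟩ := hDx n x hx
    have h1 := h f hf
    have h2 := h g hg
    rw [hfg (mem_iUnion.2 ⟨n, hd⟩)] at h1
    rw [abs_sub_comm] at h2
    linarith [abs_sub_le (f x) (g d) (g x)]

/-- A pointwise compact family whose members are determined by their values on an infinite number
`μ` of points has weight at most `μ`, as it embeds into a product of `μ` real lines. -/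
theorem topWeight_le_of_separating {Y : Type u} {𝓕 : Set (Y → ℝ)} (hcomp : IsCompact 𝓕)
    {D : Set Y} {μ : Cardinal.{u}} (hμ : ℵ₀ ≤ μ) (hD : #D ≤ μ)
    (hsep : ∀ f ∈ 𝓕, ∀ g ∈ 𝓕, EqOn f g D → f = g) : topWeight 𝓕 ≤ μ := by
  have : CompactSpace 𝓕 := isCompact_iff_compactSpace.1 hcomp
  let r : 𝓕 → D → ℝ := fun f d => f.1 d
  have hr : Continuous r :=
    continuous_pi fun d => (continuous_apply d.1).comp continuous_subtype_val
  have hrinj : Function.Injective r := fun f g h =>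
    Subtype.ext (hsep f f.2 g g.2 fun d hd => congrFun h ⟨d, hd⟩)
  have hind := (hr.isClosedEmbedding hrinj).isInducing.eq_induced
  let I := D × ℚ × ℚ
  let u : I → Set 𝓕 := fun i => {f | f.1 i.1 ∈ Ioo (i.2.1 : ℝ) (i.2.2 : ℝ)}
  have hI : #I ≤ μ := by
    have h1 : #(ℚ × ℚ) = ℵ₀ := Cardinal.mk_eq_aleph0 _
    have h2 : #I = #D * Cardinal.lift.{u} #(ℚ × ℚ) := by
      rw [Cardinal.mk_prod, Cardinal.lift_uzero]
    rw [h2, h1, Cardinal.lift_aleph0]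
    exact (mul_le_mul' hD hμ).trans (Cardinal.mul_eq_self hμ).le
  have hbasis : IsTopologicalBasis (range fun s : Finset I => ⋂ i ∈ s, u i) := by
    have hopen : ∀ i, IsOpen (u i) := fun i =>
      isOpen_Ioo.preimage ((continuous_apply _).comp continuous_subtype_val)
    refine isTopologicalBasis_of_isOpen_of_nhds ?_ ?_
    · rintro _ ⟨s, rfl⟩
      exact isOpen_biInter_finset fun i _ => hopen i
    · intro f W hfW hW
      rw [hind] at hW
      obtain ⟨V, hV, rfl⟩ := isOpen_induced_iff.1 hW
      obtain ⟨J, w, hw, hwV⟩ := isOpen_pi_iff.1 hV (r f) hfW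
      have hrat : ∀ d : D, ∃ a b : ℚ, d ∈ J → r f d ∈ Ioo (a : ℝ) b ∧ Ioo (a : ℝ) b ⊆ w d := by
        intro d
        by_cases hd : d ∈ J
        · obtain ⟨_, hB, h1, h2⟩ := Real.isTopologicalBasis_Ioo_rat.exists_subset_of_mem_open
            (hw d hd).2 (hw d hd).1
          simp only [mem_iUnion, mem_singleton_iff] at hB
          obtain ⟨a, b, -, rfl⟩ := hB
          exact ⟨a, b, fun _ => ⟨h1, h2⟩⟩
        · exact ⟨0, 0, fun h => absurd h hd⟩
      choose a b hab using hrat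
      classical
      refine ⟨_, ⟨J.image fun d => (d, a d, b d), rfl⟩, ?_, ?_⟩
      · simp only [Finset.mem_image, iInter_exists, biInter_and', iInter_iInter_eq_right, mem_iInter]
        exact fun d hd => (hab d hd).1
      · intro g hg
        simp only [Finset.mem_image, iInter_exists, biInter_and', iInter_iInter_eq_right,
          mem_iInter] at hg
        exact hwV fun d hd => (hab d hd).2 (hg d hd)
  refine (csInf_le' (s := {κ | ∃ B : Set (Set 𝓕), IsTopologicalBasis B ∧ #B = κ})
    ⟨_, hbasis, rfl⟩).trans (Cardinal.mk_range_le.trans ?_)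
  classical
  refine (Cardinal.mk_le_of_surjective (f := (List.toFinset : List I → Finset I))
    List.toFinset_surjective).trans ((Cardinal.mk_list_le_max I).trans (max_le hμ hI))

theorem compactDensity_le_closedHereditaryCompactDensity {C : Set X} (hC : IsClosed C) :
    compactDensity C ≤ closedHereditaryCompactDensity X :=
  le_ciSup (f := fun F : {F : Set X // IsClosed F} => compactDensity F.1)
    Cardinal.bddAbove_of_small ⟨C, hC⟩

/-- A closed set contains at most `h_cl kd(X)` compact sets whose union is dense in it. -/
theorem IsClosed.exists_compact_family {C : Set X} (hC : IsClosed C) :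
    ∃ 𝒞 : Set (Set X), (∀ K ∈ 𝒞, IsCompact K ∧ K ⊆ C) ∧ C ⊆ closure (⋃₀ 𝒞) ∧
      #𝒞 ≤ closedHereditaryCompactDensity X := by
  obtain ⟨𝒞, hcomp, hdense, hcard⟩ := _root_.csInf_mem (s := {κ | ∃ 𝒞 : Set (Set C),
    (∀ K ∈ 𝒞, IsCompact K) ∧ Dense (⋃₀ 𝒞) ∧ #𝒞 = κ})
    ⟨_, range fun x : C => {x}, by rintro _ ⟨x, rfl⟩; exact isCompact_singleton, by
      rw [sUnion_range, iUnion_of_singleton]; exact dense_univ, rfl⟩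
  refine ⟨image Subtype.val '' 𝒞, ?_, fun x hx => ?_, ?_⟩
  · rintro _ ⟨K, hK, rfl⟩
    exact ⟨(hcomp K hK).image continuous_subtype_val, Subtype.coe_image_subset _ _⟩
  · have h1 : (⟨x, hx⟩ : C) ∈ closure (⋃₀ 𝒞) := hdense _
    rw [closure_subtype] at h1
    rwa [sUnion_image, ← image_iUnion₂, ← sUnion_eq_biUnion]
  · refine Cardinal.mk_image_le.trans ?_
    rw [hcard]
    exact compactDensity_le_closedHereditaryCompactDensity hC

theorem one_le_closedHereditaryCompactDensity [Nonempty X] :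
    1 ≤ closedHereditaryCompactDensity X := by
  obtain ⟨𝒞, -, hdense, hcard⟩ := (isClosed_univ (X := X)).exists_compact_family
  refine le_trans ?_ hcard
  rw [Cardinal.one_le_iff_ne_zero, Cardinal.mk_ne_zero_iff, nonempty_coe_sort]
  rw [nonempty_iff_ne_empty]
  rintro rfl
  simpa using hdense (mem_univ (Classical.arbitrary X))

/-- If each non-empty set has a non-empty relatively open subset of joint continuity, the weight of
a pointwise compact family is at most `hl(X) · h_cl kd(X)`. By induction over open sets, the members
are determined by their values at that many points: a set of joint continuity in the complement of
an open set contains, by regularity, a closed set with interior points relative to this complement,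
and this closed set has a dense union of few compact sets. -/
theorem topWeight_le_of_exists_continuousOn [RegularSpace X] [Nonempty X] {𝓕 : Set (X → ℝ)}
    (hcomp : IsCompact 𝓕)
    (h : ∀ A : Set X, A.Nonempty →
      ∃ V, IsOpen V ∧ (A ∩ V).Nonempty ∧ ∀ f ∈ 𝓕, ContinuousOn f (A ∩ V)) :
    topWeight 𝓕 ≤ hereditaryLindelofNumber X * closedHereditaryCompactDensity X := by
  set μ := hereditaryLindelofNumber X * closedHereditaryCompactDensity X with hμdef
  have hlμ : hereditaryLindelofNumber X ≤ μ :=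
    le_mul_of_one_le_right' one_le_closedHereditaryCompactDensity
  have hμ : ℵ₀ ≤ μ := aleph0_le_hereditaryLindelofNumber.trans hlμ
  have hkμ : closedHereditaryCompactDensity X ≤ μ :=
    le_mul_of_one_le_left' (Cardinal.one_le_aleph0.trans aleph0_le_hereditaryLindelofNumber)
  obtain ⟨D, hD, hsep⟩ := hereditaryLindelof_induction (X := X) (P := fun O => ∃ D : Set X,
    #D ≤ μ ∧ ∀ f ∈ 𝓕, ∀ g ∈ 𝓕, EqOn f g D → EqOn f g O) (by
      intro 𝒱 hcard h𝒱
      choose! D hD hDx using h𝒱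
      refine ⟨⋃ V ∈ 𝒱, D V, mk_biUnion_le_of_le hμ hlμ hcard D hD, ?_⟩
      rintro f hf g hg hfg x ⟨V, hV, hxV⟩
      exact hDx V hV f hf g hg (hfg.mono (subset_biUnion_of_mem hV)) hxV) (by
      rintro O hO ⟨D, hD, hDO⟩ hOne
      obtain ⟨V, hV, ⟨a, haO, haV⟩, hVc⟩ := h Oᶜ (nonempty_compl.2 hOne)
      obtain ⟨C, hCa, hCc, hCV⟩ := exists_mem_nhds_isClosed_subset (hV.mem_nhds haV)
      have hcont : ∀ f ∈ 𝓕, ContinuousOn f (Oᶜ ∩ C) := fun f hf =>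
        (hVc f hf).mono (inter_subset_inter_right _ hCV)
      obtain ⟨𝒞, h𝒞, hdense, hcard⟩ := (hO.isClosed_compl.inter hCc).exists_compact_family
      have hE : ∀ K ∈ 𝒞, ∃ E : Set X, #E ≤ μ ∧ ∀ f ∈ 𝓕, ∀ g ∈ 𝓕, EqOn f g E → EqOn f g K := by
        intro K hK
        obtain ⟨E, hE, hEK⟩ := (h𝒞 K hK).1.exists_separating hcomp
          fun f hf => (hcont f hf).mono (h𝒞 K hK).2
        exact ⟨E, hE.trans hlμ, hEK⟩
      choose! E hE hEK using hE
      refine ⟨O ∪ interior C, hO.union isOpen_interior, ⟨D ∪ ⋃ K ∈ 𝒞, E K, ?_, ?_⟩, fun hsub =>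
        haO (hsub (Or.inr (mem_interior_iff_mem_nhds.2 hCa)))⟩
      · exact (Cardinal.mk_union_le _ _).trans
          (Cardinal.add_le_of_le hμ hD (mk_biUnion_le_of_le hμ hkμ hcard E hE))
      · intro f hf g hg hfg
        have hO' : EqOn f g O := hDO f hf g hg (hfg.mono subset_union_left)
        have hC' : EqOn f g (Oᶜ ∩ C) := by
          refine EqOn.of_subset_closure (s := ⋃₀ 𝒞) ?_ (hcont f hf) (hcont g hg)
            (sUnion_subset fun K hK => (h𝒞 K hK).2) hdense
          rintro x ⟨K, hK, hxK⟩
          exact hEK K hK f hf g hg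
            (hfg.mono ((subset_biUnion_of_mem hK).trans subset_union_right)) hxK
        intro x hx
        by_cases hxO : x ∈ O
        · exact hO' hxO
        · exact hC' ⟨hxO, interior_subset (hx.resolve_left hxO)⟩)
  exact topWeight_le_of_separating hcomp hμ hD fun f hf g hg hfg =>
    funext fun x => hsep f hf g hg hfg (mem_univ x)

end Cardinal

/-! ### The theorem on compact convex families -/

theorem corollary9p2 (X : Type u) [TopologicalSpace X] [RegularSpace X] [Nonempty X]
    (hT : CountablyTight X) (hR : ScatteredlyRSeparable X)
    (𝓕 : Set (X → ℝ)) (hSC : 𝓕 ⊆ SCp X) (hcomp : IsCompact 𝓕) (hconv : Convex ℝ 𝓕) :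
    WeaklyDiscontinuousFamily 𝓕 ∧
      topWeight 𝓕 ≤ hereditaryLindelofNumber X * closedHereditaryCompactDensity X := by
  have h : ∀ A : Set X, A.Nonempty →
      ∃ V, IsOpen V ∧ (A ∩ V).Nonempty ∧ ∀ f ∈ 𝓕, ContinuousOn f (A ∩ V) := fun _ hA =>
    exists_isOpen_forall_continuousOn hT hR hSC hcomp hconv hA
  exact ⟨weaklyDiscontinuousFamily_of_exists h, topWeight_le_of_exists_continuousOn hcomp h⟩
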